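/- **Setting.** Let $\mathrm{Hol}$ be the space of holomorphic functions on the upper half plane and $H=\bigoplus_{n\in\mathbb{R}}H_n$ with $H_n=\mathrm{Hol}$; write $(f,n)$ for $f$ regarded as an element of $H_n$. An endomorphism of $H$ has weight $i$ if it maps $H_n$ into $H_{n+i}$ for every $n\in\mathbb{R}$. Let $D_kf=\frac{1}{2\pi i}\frac{df}{dz}-\frac{k}{12}E_2f$, where $E_k$ is the normalized Eisenstein series of weight $k$, and define $\mathbb{C}$-linear endomorphisms of $H$ by $\delta(f,n)=(D_nf,n+2)$, $e_4(f,n)=(E_4f,n+4)$, $e_6(f,n)=(E_6f,n+6)$. Let $\mathcal{R}$ be the $\mathbb{C}$-subalgebra of $\mathrm{End}_{\mathbb{C}}(H)$ generated by $\delta,e_4,e_6$, and let $\mathcal{R}_n$ be the space of its elements of weight $n$. Let $\mathcal{M}=\bigoplus_k\mathcal{M}_k$ be the graded ring of holomorphic modular forms on $\mathrm{SL}(2,\mathbb{Z})$; identify $F\in\mathcal{M}_k$ with the operator $(f,n)\mapsto(Ff,n+k)$, so that $\mathcal{M}=\mathbb{C}[E_4,E_6]$ becomes the subalgebra of $\mathcal{R}$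 generated by $e_4,e_6$. Every $a\in\mathcal{R}\setminus\{0\}$ can be written uniquely as $a=a_n\delta^n+\cdots+a_1\delta+a_0$ with $a_k\in\mathcal{M}$ and $a_n\ne0$; put $\mathrm{ord}(a)=n$, $\mathrm{top}(a)=a_n$, and $\mathrm{ord}(0)=-\infty$, $\mathrm{top}(0)=0$. Let $\mathcal{R}^i$ (resp. $\mathcal{R}^{<i}$) be the set of $a\in\mathcal{R}$ with $\mathrm{ord}(a)=i$ (resp. $\mathrm{ord}(a)<i$), and $\mathcal{R}^i_n=\mathcal{R}^i\cap\mathcal{R}_n$, $\mathcal{R}^{<i}_n=\mathcal{R}^{<i}\cap\mathcal{R}_n$. **Theorem.** (A) (Inhomogeneous division.) Let $a\in\mathcal{R}^i$ and $b\in\mathcal{R}^j$ with $i\ge j\ge0$, and let $d,a',b'\in\mathcal{M}$ satisfy $\mathrm{top}(a)=a'd$ and $\mathrm{top}(b)=b'd$. Then 1. $\mathrm{top}(b)^{i-j}\,b'\,a=cb+c'$ for some $c\in\mathcal{R}^{i-j}$ and $c'\in\mathcal{R}^{<j}$; 2. $a\,\mathrm{top}(b)^{i-j}\,b'=bc+c'$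 for some $c\in\mathcal{R}^{i-j}$ and $c'\in\mathcal{R}^{<j}$. (B) (Homogeneous division.) Let $a\in\mathcal{R}^i_n$ and $b\in\mathcal{R}^j_m$ with $i\ge j\ge0$ and $m,n\ge0$, and let $d\in\mathcal{M}_l$, $a'\in\mathcal{M}_{n-2i-l}$, $b'\in\mathcal{M}_{m-2j-l}$ satisfy $\mathrm{top}(a)=a'd$ and $\mathrm{top}(b)=b'd$. Put $p=(m-2j)(i-j+1)-l-m+n$ and $q=(m-2j)(i-j+1)-l+n$. Then 1. $\mathrm{top}(b)^{i-j}\,b'\,a=cb+c'$ for some $c\in\mathcal{R}^{i-j}_p$ and $c'\in\mathcal{R}^{<j}_q$; 2. $a\,\mathrm{top}(b)^{i-j}\,b'=bc+c'$ for some $c\in\mathcal{R}^{i-j}_p$ and $c'\in\mathcal{R}^{<j}_q$; 3. $a\,\mathrm{top}(b)^{i-j}\,b'=cb+c'$ for some $c\in\mathcal{R}^{i-j}_p$ and $c'\in\mathcal{R}^{<j}_q$. -/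

import Mathlib

open UpperHalfPlane
open scoped Manifold MatrixGroups ModularForm DirectSum

noncomputable section

namespace MLDO

/-- The algebra `Hol` of holomorphic functions on the upper half plane. -/
def Hol : Subalgebra ℂ (ℍ → ℂ) where
  carrier := {f | MDifferentiable 𝓘(ℂ) 𝓘(ℂ) f}
  mul_mem' hf hg := MDifferentiable.mul hf hg
  add_mem' hf hg := MDifferentiable.add hf hg
  algebraMap_mem' _ := mdifferentiable_const

/-- `H = ⨁_{n ∈ ℝ} H_n` with every `H_n = Hol`. The element `(f, n)` is `Finsupp.single n f`. -/
abbrev H : Type := ℝ →₀ Hol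

/-- All `ℂ`-linear endomorphisms of `H`. -/
abbrev EndH : Type := Module.End ℂ H

/-- `End^i(H)`: the endomorphisms which map `H_n` into `H_{n+i}` for every real `n`. -/
def endWeight (i : ℝ) : Submodule ℂ EndH where
  carrier := {φ | ∀ (n : ℝ) (f : Hol), ∃ g : Hol, φ (Finsupp.single n f) = Finsupp.single (n + i) g}
  add_mem' := by
    intro φ ψ hφ hψ n f
    obtain ⟨g, hg⟩ := hφ n f
    obtain ⟨g', hg'⟩ := hψ n f
    exact ⟨g + g', by rw [LinearMap.add_apply, hg, hg', Finsupp.single_add]⟩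
  zero_mem' := fun n f => ⟨0, by simp⟩
  smul_mem' := by
    intro c φ hφ n f
    obtain ⟨g, hg⟩ := hφ n f
    exact ⟨c • g, by rw [LinearMap.smul_apply, hg, Finsupp.smul_single]⟩

/-- The endomorphism `(f, n) ↦ (T n f, n + r)` of `H`. -/
def shift (r : ℝ) (T : ℝ → (Hol →ₗ[ℂ] Hol)) : EndH :=
  Finsupp.lsum ℂ fun n => (Finsupp.lsingle (n + r)) ∘ₗ T n

theorem shift_single (r : ℝ) (T : ℝ → (Hol →ₗ[ℂ] Hol)) (n : ℝ) (f : Hol) :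
    shift r T (Finsupp.single n f) = Finsupp.single (n + r) (T n f) := by
  simp [shift]

/-- The Ramanujan-Serre operator `D_k f = (2πi)⁻¹ df/dz - (k/12) E₂ f` on `Hol`. -/
def serre (k : ℝ) : Hol →ₗ[ℂ] Hol where
  toFun f := ⟨Derivative.serreDerivative (k : ℂ) f.1,
    Derivative.serreDerivative_mdifferentiable (k : ℂ) f.2⟩
  map_add' f g := Subtype.ext (Derivative.serreDerivative_add (k : ℂ) f.1 g.1 f.2 g.2)
  map_smul' c f := Subtype.ext (Derivative.serreDerivative_smul (k : ℂ) c f.1 f.2)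

/-- `δ (f, n) = (D_n f, n + 2)`. -/
def delta : EndH := shift 2 serre

/-- A modular form of integer weight `k` on `SL(2, ℤ)`, seen as an element of `Hol`. -/
def toHol (k : ℤ) : ModularForm 𝒮ℒ k →ₗ[ℂ] Hol where
  toFun f := ⟨f, f.holo'⟩
  map_add' _ _ := rfl
  map_smul' _ _ := rfl

/-- For a modular form `F` of weight `k`, the endomorphism `(f, n) ↦ (F f, n + k)`. -/
def mulForm (k : ℤ) : ModularForm 𝒮ℒ k →ₗ[ℂ] EndH where
  toFun F := shift k fun _ => LinearMap.mulLeft ℂ (toHol k F)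
  map_add' F G := by
    refine Finsupp.lhom_ext fun n f => ?_
    rw [LinearMap.add_apply]
    simp only [shift_single, LinearMap.mulLeft_apply, map_add, add_mul, Finsupp.single_add]
  map_smul' c F := by
    refine Finsupp.lhom_ext fun n f => ?_
    rw [LinearMap.smul_apply]
    simp only [shift_single, LinearMap.mulLeft_apply, map_smul, smul_mul_assoc,
      Finsupp.smul_single, RingHom.id_apply]

theorem mulForm_single (k : ℤ) (F : ModularForm 𝒮ℒ k) (n : ℝ) (f : Hol) :
    mulForm k F (Finsupp.single n f) = Finsupp.single (n + k) (toHol k F * f) :=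
  shift_single _ _ _ _

/-- `e₄ (f, n) = (E₄ f, n + 4)`. -/
def e4 : EndH := mulForm 4 ModularForm.E₄

/-- `e₆ (f, n) = (E₆ f, n + 6)`. -/
def e6 : EndH := mulForm 6 ModularForm.E₆

/-- The algebra `R` of modular linear differential operators, generated by `δ`, `e₄`, `e₆`. -/
def R : Subalgebra ℂ EndH := Algebra.adjoin ℂ {delta, e4, e6}

/-- The weight `n` part `R_n` of `R`. -/
def RWeight (n : ℤ) : Submodule ℂ EndH := Subalgebra.toSubmodule R ⊓ endWeight (n : ℝ)

/-- The graded ring of modular forms on `SL(2, ℤ)` (there are no nonzero ones of odd weight). -/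
abbrev M : Type := ⨁ k : ℤ, ModularForm 𝒮ℒ k

/-- The weight `k` part of `M`. -/
def MWeight (k : ℤ) : Submodule ℂ M :=
  LinearMap.range (DirectSum.lof ℂ ℤ (fun k => ModularForm 𝒮ℒ k) k)

/-- The algebra homomorphism `ι : M → End(H)` which identifies a modular form `F` of weight `k`
with the operator `(f, n) ↦ (F f, n + k)`; in particular it maps `E₄` to `e₄` and `E₆` to `e₆`. -/
def iota : M →ₐ[ℂ] EndH :=
  DirectSum.toAlgebra ℂ (fun k => ModularForm 𝒮ℒ k) mulForm
    (by
      refine Finsupp.lhom_ext fun n f => ?_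
      rw [mulForm_single]
      have h : toHol 0 GradedMonoid.GOne.one = 1 := Subtype.ext (funext fun _ => rfl)
      rw [h]
      simp)
    (by
      intro k l F G
      refine Finsupp.lhom_ext fun n f => ?_
      rw [Module.End.mul_apply, mulForm_single, mulForm_single, mulForm_single]
      have h : toHol (k + l) (GradedMonoid.GMul.mul F G) = toHol k F * toHol l G :=
        Subtype.ext (funext fun _ => rfl)
      rw [h, mul_assoc]
      congr 1
      push_cast
      ring)

theorem iota_lof (k : ℤ) (F : ModularForm 𝒮ℒ k) :
    iota (DirectSum.lof ℂ ℤ (fun k => ModularForm 𝒮ℒ k) k F) = mulForm k F :=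
  DirectSum.toModule_lof ℂ (φ := mulForm) k F

/-- The operator `a_n δ^n + ⋯ + a_1 δ + a_0` with coefficients `a_k ∈ M`. The polynomial only
records the finite sequence of coefficients; its multiplication plays no role. -/
def ofCoeffs (P : Polynomial M) : EndH := P.sum fun k f => iota f * delta ^ k

open Classical in
/-- The coefficients `a_k ∈ M` in the (unique) expression `a = a_n δ^n + ⋯ + a_1 δ + a_0`.
Every element of `R` has such an expression; the value is `0` for operators that have none. -/
def coeffs (a : EndH) : Polynomial M :=
  if h : ∃ P : Polynomial M, ofCoeffs P = a then h.choose else 0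

/-- The order of an operator; it is `⊥`, that is `-∞`, for `a = 0`. -/
def ord (a : EndH) : WithBot ℕ := (coeffs a).degree

/-- The top of an operator, that is the coefficient of its highest power of `δ`;
it is `0` for `a = 0`. -/
def top (a : EndH) : M := (coeffs a).leadingCoeff

end MLDO

end

noncomputable section

namespace MLDO

/-! ### The graded ring of modular forms is a domain -/

section

open ModularForm EisensteinSeries

/-! The rule δf = fδ + D(f), with D the Serre derivative on M, puts every operator of R in the form
Σ f_k δ^k. Commutators with elements of M lower the order, so orders add and leading coefficients
multiply as in the commutative ring M[δ] (`HasSymbol.mul`). The coefficients are unique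
(`ofCoeffs_injective`), and M is a domain.

Division is therefore pseudo-division of polynomials. Put r = i - j and β = top(b) = b'd. The
operators b'a and a'δ^r b have the same leading coefficient b'a'd, so their difference has order
below i. Each further factor β lowers the bound by one, and β^r brings it below j. The version with
b on the left is symmetric.

In B.3 the multiplier stands on the right of a but the quotient on the left of b. Moving δ^l to the
right past β^r b' costs at most one power of β for each derivative spent on the coefficient, and
each such derivative also costs one order of δ. The surviving powers of β thus still suffice for
division. At l = i one more β is needed; the factor d of top(a) = a'd supplies it together with b'
(`mul_iota_mem_leftDivisible_of_symbol`).

For weights, quotient and remainder are replaced by their homogeneous parts. The order of the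
quotient follows from additivity of orders. -/

instance : NoZeroDivisors Hol where
  eq_zero_or_eq_zero_of_mul_eq_zero := by
    rintro ⟨f, hf⟩ ⟨g, hg⟩ h
    have key : ∀ f : ℍ → ℂ, MDifferentiable 𝓘(ℂ) 𝓘(ℂ) f →
        AnalyticOnNhd ℂ (f ∘ ofComplex) upperHalfPlaneSet := fun f hf =>
      (UpperHalfPlane.mdifferentiable_iff.mp hf).analyticOnNhd isOpen_upperHalfPlaneSet
    have hU : IsPreconnected upperHalfPlaneSet := (convex_halfSpace_im_gt 0).isPreconnected
    have hz : ∀ f : ℍ → ℂ, (∀ z ∈ upperHalfPlaneSet, (f ∘ ofComplex) z = 0) → f = 0 := by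
      intro f h
      ext z
      simpa using h z z.im_pos
    have h' : f * g = 0 := congrArg Subtype.val h
    refine (AnalyticOnNhd.eq_zero_or_eq_zero_of_mul_eq_zero (key f hf) (key g hg) ?_ hU).imp
      (fun h => Subtype.ext (hz f h)) (fun h => Subtype.ext (hz g h))
    intro z _
    exact congrFun h' (ofComplex z)

theorem toHol_injective (k : ℤ) : Function.Injective (toHol k) := fun _ _ h =>
  DFunLike.coe_injective (congrArg Subtype.val h)

/-- The expansion of an element of `M` as a Laurent polynomial with holomorphic coefficients. -/
def toLaurent : M →ₐ[ℂ] AddMonoidAlgebra Hol ℤ :=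
  DirectSum.toAlgebra ℂ (fun k => ModularForm 𝒮ℒ k)
    (fun k => (AddMonoidAlgebra.lsingle k : Hol →ₗ[ℂ] AddMonoidAlgebra Hol ℤ) ∘ₗ toHol k)
    rfl
    (by
      intro k l F G
      simp only [LinearMap.comp_apply, AddMonoidAlgebra.lsingle_apply,
        AddMonoidAlgebra.single_mul_single]
      rfl)

theorem toLaurent_of (k : ℤ) (F : ModularForm 𝒮ℒ k) :
    toLaurent (DirectSum.of (ModularForm 𝒮ℒ) k F) = AddMonoidAlgebra.single k (toHol k F) :=
  DirectSum.toModule_lof ℂ (φ := fun k =>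
    (AddMonoidAlgebra.lsingle k : Hol →ₗ[ℂ] AddMonoidAlgebra Hol ℤ) ∘ₗ toHol k) k F

theorem toLaurent_coeff (x : M) (k : ℤ) : (toLaurent x).coeff k = toHol k (x k) := by
  induction x using DirectSum.induction_on with
  | zero => simp
  | add x y hx hy => simp [hx, hy]
  | of l F =>
    rw [toLaurent_of, AddMonoidAlgebra.coeff_single]
    rcases eq_or_ne l k with rfl | h
    · rw [Finsupp.single_eq_same, DirectSum.of_eq_same]
    · rw [Finsupp.single_eq_of_ne h.symm, DirectSum.of_eq_of_ne _ _ _ h.symm, map_zero]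

/-- Laurent polynomials over the domain `Hol` form a domain, and recording each weight separately
loses nothing. -/
instance : NoZeroDivisors M :=
  Function.Injective.noZeroDivisors toLaurent
    (fun x y h => DFinsupp.ext fun k => toHol_injective k (by
      rw [← toLaurent_coeff, h, toLaurent_coeff])) (map_zero _) (map_mul _)

/-! ### The Serre derivative of a modular form -/

theorem normalizedDeriv_isBoundedAtImInfty {f : ℍ → ℂ} (hf : MDifferentiable 𝓘(ℂ) 𝓘(ℂ) f)
    (hb : IsBoundedAtImInfty f) : IsBoundedAtImInfty (Derivative.normalizedDerivOfComplex f) := by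
  rw [isBoundedAtImInfty_iff] at hb ⊢
  obtain ⟨C, A, h⟩ := hb
  -- Cauchy's estimate on the unit disc about z. The extra 1 keeps that disc above height max A 1,
  -- hence inside the half plane and in the region where C bounds f.
  refine ⟨‖(2 * Real.pi * Complex.I : ℂ)⁻¹‖ * C, max A 1 + 1, fun z hz => ?_⟩
  rw [Derivative.normalizedDerivOfComplex, norm_mul]
  gcongr
  have him : ∀ w ∈ Metric.closedBall (z : ℂ) 1, max A 1 ≤ w.im := by
    intro w hw
    have h1 : |(w - z).im| ≤ 1 :=
      (Complex.abs_im_le_norm _).trans (by simpa [dist_eq_norm] using hw)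
    have h2 : (z : ℂ).im = z.im := rfl
    rw [Complex.sub_im, h2] at h1
    have := (abs_le.mp h1).1
    linarith
  refine (Complex.norm_deriv_le_of_forall_mem_sphere_norm_le (C := C) one_pos
    (DifferentiableOn.diffContOnCl_ball (U := upperHalfPlaneSet)
      (UpperHalfPlane.mdifferentiable_iff.mp hf) fun w hw => ?_) fun w hw => ?_).trans_eq
    (div_one C)
  · exact zero_lt_one.trans_le ((le_max_right A 1).trans (him w hw))
  · have hw' := him w (Metric.sphere_subset_closedBall hw)
    have hpos : 0 < w.im := zero_lt_one.trans_le ((le_max_right A 1).trans hw')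
    rw [Function.comp_apply, ofComplex_apply_of_im_pos hpos]
    exact h _ ((le_max_left A 1).trans hw')

theorem serreDerivative_isBoundedAtImInfty {k : ℂ} {f : ℍ → ℂ}
    (hf : MDifferentiable 𝓘(ℂ) 𝓘(ℂ) f) (hb : IsBoundedAtImInfty f) :
    IsBoundedAtImInfty (Derivative.serreDerivative k f) := by
  have h := (normalizedDeriv_isBoundedAtImInfty hf hb).sub
    (((isBoundedAtImInfty_E2).mul hb).smul (k * 12⁻¹))
  refine (congrArg IsBoundedAtImInfty (funext fun z => ?_)).mpr h
  simp [mul_assoc]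

/-- The Serre derivative of a modular form. -/
def serreForm (k : ℤ) (F : ModularForm 𝒮ℒ k) : ModularForm 𝒮ℒ (k + 2) where
  toFun := Derivative.serreDerivative k F
  slash_action_eq' := by
    rintro _ ⟨γ, rfl⟩
    exact Derivative.serreDerivative_slash_invariant F.holo' (F.slash_action_eq' _ ⟨γ, rfl⟩)
  holo' := Derivative.serreDerivative_mdifferentiable _ F.holo'
  bdd_at_cusps' hc := by
    rw [Subgroup.IsArithmetic.isCusp_iff_isCusp_SL2Z] at hc
    rw [OnePoint.isBoundedAt_iff_forall_SL2Z hc]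
    intro γ _
    refine (congrArg IsBoundedAtImInfty (Derivative.serreDerivative_slash_invariant F.holo'
      (F.slash_action_eq' _ ⟨γ, rfl⟩))).mpr ?_
    exact serreDerivative_isBoundedAtImInfty F.holo' (ModularFormClass.bdd_at_infty F)

/-! ### Generation by E₄ and E₆ -/

theorem exists_mem_adjoin_qExpansion_coeff_zero (k : ℕ) (hk : Even k) (hk4 : 4 ≤ k) :
    ∃ g : ModularForm 𝒮ℒ k, DirectSum.of (ModularForm 𝒮ℒ) k g ∈
      Algebra.adjoin ℂ {DirectSum.of (ModularForm 𝒮ℒ) 4 E₄, DirectSum.of (ModularForm 𝒮ℒ) 6 E₆} ∧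
      (qExpansion 1 g).coeff 0 = 1 := by
  obtain ⟨a, b, hab⟩ : ∃ a b : ℕ, (k : ℤ) = (a : ℤ) * 4 + (b : ℤ) * 6 := by
    obtain ⟨r, rfl⟩ := hk
    rcases Nat.even_or_odd' r with ⟨s, rfl | rfl⟩
    · exact ⟨s, 0, by push_cast; ring⟩
    -- Here k = 4s + 2 = 4(s - 1) + 6, and k ≥ 4 gives s ≥ 1.
    · exact ⟨s - 1, 1, by omega⟩
  rw [hab]
  refine ⟨(E₄.pow a).mul (E₆.pow b), ?_, ?_⟩
  · have : DirectSum.of (ModularForm 𝒮ℒ) ((a : ℤ) * 4 + (b : ℤ) * 6) ((E₄.pow a).mul (E₆.pow b)) =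
        DirectSum.of (ModularForm 𝒮ℒ) 4 E₄ ^ a * DirectSum.of (ModularForm 𝒮ℒ) 6 E₆ ^ b := by
      rw [directSum_of_pow, directSum_of_pow, DirectSum.of_mul_of]
      rfl
    rw [this]
    exact mul_mem (pow_mem (Algebra.subset_adjoin (by simp)) _)
      (pow_mem (Algebra.subset_adjoin (by simp)) _)
  · rw [show ⇑((E₄.pow a).mul (E₆.pow b)) = ⇑(E₄.pow a) * ⇑(E₆.pow b) from rfl,
      ModularForm.qExpansion_mul_coe one_pos one_mem_strictPeriods_SL,
      ModularForm.qExpansion_pow one_pos one_mem_strictPeriods_SL,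
      ModularForm.qExpansion_pow one_pos one_mem_strictPeriods_SL]
    have h4 := E_qExpansion_coeff_zero (k := 4) (by norm_num) ⟨2, rfl⟩
    have h6 := E_qExpansion_coeff_zero (k := 6) (by norm_num) ⟨3, rfl⟩
    rw [PowerSeries.coeff_zero_eq_constantCoeff] at *
    rw [map_mul, map_pow, map_pow, h4, h6, one_pow, one_pow, one_mul]

/-- Subtracting a multiple of a monomial E₄^a E₆^b removes the constant term. The resulting cusp
form is Δ times a form of weight k - 12, and Δ is a multiple of E₄³ - E₆². -/
theorem of_mem_adjoin (k : ℕ) (f : ModularForm 𝒮ℒ k) : DirectSum.of (ModularForm 𝒮ℒ) k f ∈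
      Algebra.adjoin ℂ {DirectSum.of (ModularForm 𝒮ℒ) 4 E₄, DirectSum.of (ModularForm 𝒮ℒ) 6 E₆} := by
  induction k using Nat.strong_induction_on with | h k ih =>
  rcases Nat.even_or_odd k with hk | hk
  swap
  · rw [levelOne_odd_weight_eq_zero (mod_cast hk) f, map_zero]
    exact zero_mem _
  rcases lt_or_ge k 4 with hk4 | hk4
  · obtain rfl | rfl : k = 0 ∨ k = 2 := by
      obtain ⟨r, rfl⟩ := hk
      omega
    · obtain ⟨c, hc⟩ := ModularFormClass.levelOne_weight_zero_const (f : ModularForm 𝒮ℒ 0)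
      have : DirectSum.of (ModularForm 𝒮ℒ) 0 f = algebraMap ℂ M c := by
        rw [DirectSum.algebraMap_apply]
        congr 1
        ext z
        exact congrFun hc z
      exact this ▸ Subalgebra.algebraMap_mem _ c
    · rw [rank_zero_iff_forall_zero.mp levelOne_weight_two_rank_zero f, map_zero]
      exact zero_mem _
  obtain ⟨g, hg, hg1⟩ := exists_mem_adjoin_qExpansion_coeff_zero k hk hk4
  obtain ⟨s, hs⟩ := sub_smul_isCuspForm f g hg1
  have hf : f = (qExpansion 1 f).coeff 0 • g + s.toModularFormₗ := by
    rw [hs, add_sub_cancel]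
  rw [hf, map_add, DirectSum.of_smul]
  refine add_mem (Subalgebra.smul_mem _ hg _) ?_
  have hmul : DirectSum.of (ModularForm 𝒮ℒ) k s.toModularFormₗ =
      DirectSum.of (ModularForm 𝒮ℒ) 12 (CuspForm.toModularFormₗ CuspForm.discriminant) *
        DirectSum.of (ModularForm 𝒮ℒ) (k - 12) (CuspForm.discriminantEquiv s) := by
    rw [DirectSum.of_mul_of]
    refine DirectSum.of_eq_of_gradedMonoid_eq (gradedMonoid_eq_of_cast
      (show (k : ℤ) = 12 + (k - 12) by ring) ?_)
    ext z
    exact (discriminant_mul_discriminantEquiv_apply s z).symm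
  rw [hmul]
  refine mul_mem ?_ ?_
  · have := discriminant_eq_E₄_cube_sub_E₆_sq_graded
    refine this ▸ Subalgebra.smul_mem _ (sub_mem (pow_mem (Algebra.subset_adjoin (by simp)) _)
      (pow_mem (Algebra.subset_adjoin (by simp)) _)) _
  · rcases lt_or_ge k 12 with h12 | h12
    · rw [rank_zero_iff_forall_zero.mp (levelOne_neg_weight_rank_zero (by omega))
        (CuspForm.discriminantEquiv s), map_zero]
      exact zero_mem _
    · generalize CuspForm.discriminantEquiv s = t
      obtain ⟨l, hl⟩ : ∃ l : ℕ, (k : ℤ) - 12 = l := ⟨k - 12, by omega⟩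
      revert t
      rw [hl]
      exact ih l (by omega)

theorem adjoin_eq_top : Algebra.adjoin ℂ
    {DirectSum.of (ModularForm 𝒮ℒ) 4 E₄, DirectSum.of (ModularForm 𝒮ℒ) 6 E₆} = ⊤ := by
  refine eq_top_iff.mpr fun x _ => ?_
  induction x using DirectSum.induction_on with
  | zero => exact zero_mem _
  | add x y hx hy => exact add_mem (hx trivial) (hy trivial)
  | of k F =>
    rcases lt_or_ge k 0 with hk | hk
    · rw [rank_zero_iff_forall_zero.mp (levelOne_neg_weight_rank_zero hk) F, map_zero]
      exact zero_mem _
    · lift k to ℕ using hk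
      exact of_mem_adjoin k F

end

/-! ### Commutation of δ with multiplication operators -/

instance : Ring EndH := Algebra.semiringToRing ℂ

/-- Leibniz rule D_{n+k}(Ff) = F D_n f + (D_k F) f: the E₂ terms add up because the weights do. -/
theorem delta_mul_mulForm (k : ℤ) (F : ModularForm 𝒮ℒ k) :
    delta * mulForm k F = mulForm k F * delta + mulForm (k + 2) (serreForm k F) := by
  refine Finsupp.lhom_ext fun n f => ?_
  rw [LinearMap.add_apply, Module.End.mul_apply, Module.End.mul_apply, mulForm_single,
    mulForm_single, delta, shift_single, shift_single, mulForm_single]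
  have h : serre (n + k) (toHol k F * f) =
      toHol k F * serre n f + toHol (k + 2) (serreForm k F) * f := by
    apply Subtype.ext
    have := Derivative.serreDerivative_mul (k : ℂ) (n : ℂ) F f.1 F.holo' f.2
    change Derivative.serreDerivative ((n + k : ℝ) : ℂ) (⇑F * f.1) =
      ⇑F * Derivative.serreDerivative n f.1 + Derivative.serreDerivative k F * f.1
    rw [add_comm (⇑F * _), ← this]
    congr 1
    push_cast
    ring
  rw [h, Finsupp.single_add]
  congr 2 <;> push_cast <;> ring

theorem iota_of (k : ℤ) (F : ModularForm 𝒮ℒ k) :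
    iota (DirectSum.of (ModularForm 𝒮ℒ) k F) = mulForm k F :=
  iota_lof k F

theorem exists_delta_mul_iota (f : M) : ∃ g, delta * iota f = iota f * delta + iota g := by
  induction f using DirectSum.induction_on with
  | zero => exact ⟨0, by simp⟩
  | add x y hx hy =>
    obtain ⟨g, hg⟩ := hx
    obtain ⟨h, hh⟩ := hy
    exact ⟨g + h, by rw [map_add, mul_add, hg, hh, map_add, add_mul]; abel⟩
  | of k F =>
    exact ⟨DirectSum.of (ModularForm 𝒮ℒ) (k + 2) (serreForm k F), by
      rw [iota_of, iota_of, delta_mul_mulForm]⟩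

/-- This is where generation of M by E₄ and E₆ enters: every operator with coefficients in M lies in
R. -/
theorem iota_mem_R (f : M) : iota f ∈ R := by
  have h : f ∈ Algebra.adjoin ℂ {DirectSum.of (ModularForm 𝒮ℒ) 4 ModularForm.E₄,
      DirectSum.of (ModularForm 𝒮ℒ) 6 ModularForm.E₆} := adjoin_eq_top ▸ trivial
  induction h using Algebra.adjoin_induction with
  | mem x hx =>
    rcases hx with rfl | rfl
    · rw [iota_of]
      exact Algebra.subset_adjoin (by simp [e4])
    · rw [iota_of]
      exact Algebra.subset_adjoin (by simp [e6])
  | algebraMap c => rw [AlgHom.commutes]; exact Subalgebra.algebraMap_mem _ c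
  | add x y _ _ hx hy => rw [map_add]; exact add_mem hx hy
  | mul x y _ _ hx hy => rw [map_mul]; exact mul_mem hx hy

theorem delta_mem_R : delta ∈ R := Algebra.subset_adjoin (by simp)

/-! ### Order filtration and leading coefficients -/

/-- The operators of order less than `n`. -/
def filt (n : ℕ) : Submodule ℂ EndH :=
  Submodule.span ℂ {a | ∃ k < n, ∃ f, iota f * delta ^ k = a}

theorem gen_mem_filt {n k : ℕ} (h : k < n) (f : M) : iota f * delta ^ k ∈ filt n :=
  Submodule.subset_span ⟨k, h, f, rfl⟩

theorem filt_mono {m n : ℕ} (h : m ≤ n) : filt m ≤ filt n :=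
  Submodule.span_mono fun _ ⟨k, hk, f, e⟩ => ⟨k, hk.trans_le h, f, e⟩

theorem iota_mem_filt (f : M) : iota f ∈ filt 1 := by
  simpa using gen_mem_filt one_pos f

theorem filt_le_R (n : ℕ) : filt n ≤ Subalgebra.toSubmodule R := by
  refine Submodule.span_le.mpr ?_
  rintro _ ⟨k, -, f, rfl⟩
  exact R.mul_mem (iota_mem_R f) (R.pow_mem delta_mem_R k)

theorem iota_mul_mem_filt {n : ℕ} {a : EndH} (f : M) (ha : a ∈ filt n) : iota f * a ∈ filt n := by
  have : filt n ≤ (filt n).comap (LinearMap.mulLeft ℂ (iota f)) := by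
    refine Submodule.span_le.mpr ?_
    rintro _ ⟨k, hk, g, rfl⟩
    simpa [← mul_assoc, ← map_mul] using gen_mem_filt hk (f * g)
  exact this ha

theorem delta_mul_mem_filt {n : ℕ} {a : EndH} (ha : a ∈ filt n) : delta * a ∈ filt (n + 1) := by
  have : filt n ≤ (filt (n + 1)).comap (LinearMap.mulLeft ℂ delta) := by
    refine Submodule.span_le.mpr ?_
    rintro _ ⟨k, hk, g, rfl⟩
    obtain ⟨g', hg⟩ := exists_delta_mul_iota g
    have h : delta * (iota g * delta ^ k) = iota g * delta ^ (k + 1) + iota g' * delta ^ k := by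
      rw [← mul_assoc, hg, add_mul, pow_succ', mul_assoc]
    simpa [h] using add_mem (gen_mem_filt (by omega) _) (gen_mem_filt (by omega) _)
  exact this ha

theorem delta_pow_mul_mem_filt {n : ℕ} {a : EndH} (k : ℕ) (ha : a ∈ filt n) :
    delta ^ k * a ∈ filt (n + k) := by
  induction k with
  | zero => simpa using ha
  | succ k ih =>
    rw [pow_succ', mul_assoc]
    exact delta_mul_mem_filt ih

/-- The bounds are strict: orders at most n - 1 and m - 1 give a product of order at most n + m - 2,
which is below s. -/
theorem mul_mem_filt {n m s : ℕ} (h : n + m ≤ s + 1) {a b : EndH} (ha : a ∈ filt n)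
    (hb : b ∈ filt m) : a * b ∈ filt s := by
  have : filt n ≤ (filt s).comap (LinearMap.mulRight ℂ b) := by
    refine Submodule.span_le.mpr ?_
    rintro _ ⟨k, hk, g, rfl⟩
    change iota g * delta ^ k * b ∈ filt s
    rw [mul_assoc]
    exact iota_mul_mem_filt g (filt_mono (by omega) (delta_pow_mul_mem_filt k hb))
  exact this ha

theorem exists_mem_filt {a : EndH} (ha : a ∈ R) : ∃ n, a ∈ filt n := by
  induction ha using Algebra.adjoin_induction with
  | mem x hx =>
    rcases hx with rfl | rfl | rfl
    · exact ⟨2, by simpa using gen_mem_filt one_lt_two (1 : M)⟩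
    · exact ⟨1, by simpa [iota_of, e4, e6] using iota_mem_filt (DirectSum.of (ModularForm 𝒮ℒ) 4 _)⟩
    · exact ⟨1, by simpa [iota_of, e4, e6] using iota_mem_filt (DirectSum.of (ModularForm 𝒮ℒ) 6 _)⟩
  | algebraMap c => exact ⟨1, by simpa using iota_mem_filt (algebraMap ℂ M c)⟩
  | add x y _ _ hx hy =>
    obtain ⟨n, hn⟩ := hx
    obtain ⟨m, hm⟩ := hy
    exact ⟨n + m, add_mem (filt_mono (by omega) hn) (filt_mono (by omega) hm)⟩
  | mul x y _ _ hx hy =>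
    obtain ⟨n, hn⟩ := hx
    obtain ⟨m, hm⟩ := hy
    exact ⟨n + m, mul_mem_filt (by omega) hn hm⟩

/-- The operator `a` has order at most `n`, with coefficient `f` at `δ ^ n`. -/
def HasSymbol (n : ℕ) (f : M) (a : EndH) : Prop := a - iota f * delta ^ n ∈ filt n

theorem HasSymbol.mem {n : ℕ} {f : M} {a : EndH} (h : HasSymbol n f a) : a ∈ filt (n + 1) := by
  have := add_mem (filt_mono n.le_succ h) (gen_mem_filt n.lt_succ_self f)
  rwa [sub_add_cancel] at this

theorem hasSymbol_gen (n : ℕ) (f : M) : HasSymbol n f (iota f * delta ^ n) := by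
  simp [HasSymbol]

theorem hasSymbol_iota (f : M) : HasSymbol 0 f (iota f) := by
  simp [HasSymbol]

theorem hasSymbol_delta_pow (n : ℕ) : HasSymbol n 1 (delta ^ n) := by
  simp [HasSymbol]

theorem HasSymbol.sub_mem_filt {n : ℕ} {f : M} {a b : EndH} (ha : HasSymbol n f a)
    (hb : HasSymbol n f b) : a - b ∈ filt n := by
  simpa using sub_mem ha hb

theorem HasSymbol.of_sub_mem {n : ℕ} {f : M} {a b : EndH} (ha : HasSymbol n f a)
    (hb : a - b ∈ filt n) : HasSymbol n f b := by
  have := sub_mem ha hb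
  rwa [HasSymbol, show b - iota f * delta ^ n = a - iota f * delta ^ n - (a - b) by abel]

/-- The coefficient may be zero, so the exact order of a need not be known in the division steps. -/
theorem exists_hasSymbol {n : ℕ} {a : EndH} (ha : a ∈ filt (n + 1)) : ∃ f, HasSymbol n f a := by
  induction ha using Submodule.span_induction with
  | mem x hx =>
    obtain ⟨k, hk, f, rfl⟩ := hx
    rcases (Nat.lt_succ_iff_lt_or_eq.mp hk) with hk | rfl
    · exact ⟨0, by simpa [HasSymbol] using gen_mem_filt hk f⟩
    · exact ⟨f, hasSymbol_gen _ f⟩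
  | zero => exact ⟨0, by simp [HasSymbol]⟩
  | add x y _ _ hx hy =>
    obtain ⟨f, hf⟩ := hx
    obtain ⟨g, hg⟩ := hy
    refine ⟨f + g, ?_⟩
    have := add_mem hf hg
    rwa [HasSymbol, map_add, add_mul, add_sub_add_comm]
  | smul c x _ hx =>
    obtain ⟨f, hf⟩ := hx
    refine ⟨c • f, ?_⟩
    have := Submodule.smul_mem _ c hf
    rwa [HasSymbol, map_smul, smul_mul_assoc, ← smul_sub]

theorem hasSymbol_delta_pow_mul_iota (n : ℕ) (f : M) : HasSymbol n f (delta ^ n * iota f) := by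
  induction n with
  | zero => simpa using hasSymbol_iota f
  | succ n ih =>
    obtain ⟨g, hg⟩ := exists_delta_mul_iota f
    have h := add_mem (delta_mul_mem_filt ih) (gen_mem_filt n.lt_succ_self g)
    rw [HasSymbol]
    convert h using 1
    rw [mul_sub, ← mul_assoc delta (iota f), hg, pow_succ' delta n]
    noncomm_ring

/-- The associated graded ring is commutative, because [δ^n, g] has order below n. -/
theorem HasSymbol.mul {n m : ℕ} {f g : M} {a b : EndH} (ha : HasSymbol n f a)
    (hb : HasSymbol m g b) : HasSymbol (n + m) (f * g) (a * b) := by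
  -- The error is split as (a - fδ^n)b + fδ^n(b - gδ^m) + f[δ^n, g]δ^m.
  have h1 : (a - iota f * delta ^ n) * b ∈ filt (n + m) := mul_mem_filt (by omega) ha hb.mem
  have h2 : iota f * (delta ^ n * (b - iota g * delta ^ m)) ∈ filt (n + m) :=
    iota_mul_mem_filt f (add_comm m n ▸ delta_pow_mul_mem_filt n hb)
  have h3 : iota f * ((delta ^ n * iota g - iota g * delta ^ n) * delta ^ m) ∈ filt (n + m) :=
    iota_mul_mem_filt f
      (mul_mem_filt (by omega) (hasSymbol_delta_pow_mul_iota n g) (hasSymbol_delta_pow m).mem)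
  rw [HasSymbol]
  convert add_mem (add_mem h1 h2) h3 using 1
  rw [pow_add, map_mul]
  noncomm_ring

/-! ### Uniqueness of the coefficients -/

theorem iota_single_apply (f : M) (n : ℝ) (g : Hol) (k : ℤ) :
    (iota f (Finsupp.single n g)) (n + k) = toHol k (f k) * g := by
  induction f using DirectSum.induction_on with
  | zero => simp
  | add x y hx hy => simp [hx, hy, add_mul]
  | of l F =>
    rw [iota_of, mulForm_single]
    rcases eq_or_ne l k with rfl | h
    · rw [Finsupp.single_eq_same, DirectSum.of_eq_same]
    · rw [Finsupp.single_eq_of_ne (by simpa using h.symm), DirectSum.of_eq_of_ne _ _ _ h.symm,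
        map_zero, zero_mul]

/-- The function `z ↦ z - z₀` on the upper half plane. -/
def subConst (z₀ : ℍ) : Hol :=
  ⟨fun z => (z : ℂ) - z₀, (UpperHalfPlane.mdifferentiable_coe).sub mdifferentiable_const⟩

/-- The Serre derivative lowers the vanishing order at z₀ by exactly one when h(z₀) ≠ 0: the E₂ term
keeps the full power of z - z₀ and does not affect the leading term. -/
theorem serre_subConst_pow_mul (z₀ : ℍ) (n : ℝ) (s : ℕ) (h : Hol) :
    ∃ h' : Hol, serre n (subConst z₀ ^ (s + 1) * h) = subConst z₀ ^ s * h' ∧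
      h'.1 z₀ = (s + 1) * (2 * Real.pi * Complex.I)⁻¹ * h.1 z₀ := by
  have hD : Derivative.normalizedDerivOfComplex (subConst z₀).1 =
      fun _ => (2 * Real.pi * Complex.I : ℂ)⁻¹ := by
    ext z
    rw [Derivative.normalizedDerivOfComplex]
    have : deriv ((subConst z₀).1 ∘ ofComplex) z = 1 := by
      have h1 : (subConst z₀).1 ∘ ofComplex =ᶠ[nhds (z : ℂ)] fun w => w - z₀ := by
        filter_upwards [isOpen_upperHalfPlaneSet.mem_nhds z.im_pos] with w hw
        simp [subConst, ofComplex_apply_of_im_pos hw]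
      rw [h1.deriv_eq]
      simp
    rw [this, mul_one]
  refine ⟨((s + 1) * (2 * Real.pi * Complex.I)⁻¹ : ℂ) • h + subConst z₀ * serre n h, ?_, ?_⟩
  · apply Subtype.ext
    funext z
    have h1 := Derivative.normalizedDerivOfComplex_mul _ _ (subConst z₀ ^ (s + 1)).2 h.2
    have h2 := Derivative.normalizedDerivOfComplex_pow _ (s + 1) (subConst z₀).2
    have h3 := congrFun h1 z
    have h4 := congrFun h2 z
    rw [hD] at h4
    change Derivative.normalizedDerivOfComplex ((subConst z₀ ^ (s + 1)).1 * h.1) z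
      - n * 12⁻¹ * EisensteinSeries.E2 z * ((subConst z₀).1 z ^ (s + 1) * h.1 z) = (subConst z₀).1 z ^ s *
      (((s + 1) * (2 * Real.pi * Complex.I)⁻¹ : ℂ) * h.1 z + (subConst z₀).1 z *
        (Derivative.normalizedDerivOfComplex h.1 z - n * 12⁻¹ * EisensteinSeries.E2 z * h.1 z))
    rw [h3]
    change Derivative.normalizedDerivOfComplex ((subConst z₀).1 ^ (s + 1)) z * h.1 z +
      (subConst z₀).1 z ^ (s + 1) * Derivative.normalizedDerivOfComplex h.1 z - _ = _
    rw [h4]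
    change (((s + 1 : ℕ) : ℂ) * (subConst z₀).1 z ^ s * (2 * Real.pi * Complex.I)⁻¹) * h.1 z +
      _ - _ = _
    push_cast
    ring
  · have h0 : (subConst z₀).1 z₀ = 0 := sub_self _
    change ((s + 1) * (2 * Real.pi * Complex.I)⁻¹ : ℂ) * h.1 z₀ +
      (subConst z₀).1 z₀ * (serre n h).1 z₀ = _
    rw [h0, zero_mul, add_zero]

theorem delta_pow_single_subConst (z₀ : ℍ) (n : ℝ) (N l : ℕ) (hl : l ≤ N) :
    ∃ h : Hol, (delta ^ l) (Finsupp.single n (subConst z₀ ^ N)) =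
      Finsupp.single (n + 2 * l) (subConst z₀ ^ (N - l) * h) ∧ h.1 z₀ ≠ 0 := by
  induction l with
  | zero => exact ⟨1, by simp, one_ne_zero⟩
  | succ l ih =>
    obtain ⟨h, h1, h2⟩ := ih (by omega)
    obtain ⟨h', h3, h4⟩ := serre_subConst_pow_mul z₀ (n + 2 * l) (N - (l + 1)) h
    refine ⟨h', ?_, ?_⟩
    · rw [pow_succ', Module.End.mul_apply, h1, delta, shift_single,
        show N - l = N - (l + 1) + 1 by omega, h3]
      congr 1
      push_cast
      ring
    · rw [h4]
      refine mul_ne_zero (mul_ne_zero (Nat.cast_add_one_ne_zero _) ?_) h2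
      exact inv_ne_zero Complex.two_pi_I_ne_zero

theorem ofCoeffs_add (P Q : Polynomial M) : ofCoeffs (P + Q) = ofCoeffs P + ofCoeffs Q :=
  Polynomial.sum_add_index _ _ _ (by simp) (by simp [add_mul])

theorem ofCoeffs_monomial (n : ℕ) (f : M) :
    ofCoeffs (Polynomial.monomial n f) = iota f * delta ^ n :=
  Polynomial.sum_monomial_index _ _ (by simp)

/-- Applied to (z - z₀)^N with N the degree, δ^l leaves a zero of order N - l at z₀. Evaluation at
z₀ thus sees only the term l = N, so the leading coefficient vanishes at every z₀. -/
theorem eq_zero_of_ofCoeffs_eq_zero {P : Polynomial M} (h : ofCoeffs P = 0) : P = 0 := by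
  by_contra hP
  apply Polynomial.leadingCoeff_ne_zero.mpr hP
  refine DFinsupp.ext fun k => DFunLike.ext _ _ fun z₀ => ?_
  set N := P.natDegree with hN
  -- The component 2N + k isolates the weight k part of the leading coefficient, since δ^N raises
  -- the index by 2N.
  have h1 := congrArg (fun φ : EndH => (φ (Finsupp.single 0 (subConst z₀ ^ N)) (2 * N + k)).1 z₀) h
  have key : ∀ l ≤ N, ∃ h : Hol, h.1 z₀ ≠ 0 ∧
      (iota (P.coeff l) * delta ^ l) (Finsupp.single 0 (subConst z₀ ^ N)) (2 * N + k) =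
        toHol (k + 2 * (N - l)) (P.coeff l (k + 2 * (N - l))) * (subConst z₀ ^ (N - l) * h) := by
    intro l hl
    obtain ⟨h, h2, h3⟩ := delta_pow_single_subConst z₀ 0 N l hl
    refine ⟨h, h3, ?_⟩
    rw [Module.End.mul_apply, h2, ← iota_single_apply]
    congr 1
    push_cast
    ring
  have hsum : ofCoeffs P = ∑ l ∈ Finset.range (N + 1), iota (P.coeff l) * delta ^ l :=
    Polynomial.sum_over_range _ (by simp)
  rw [hsum, Finset.sum_range_succ] at h1
  obtain ⟨g, hg, hg'⟩ := key N le_rfl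
  have hlow : (((∑ l ∈ Finset.range N, iota (P.coeff l) * delta ^ l)
      (Finsupp.single 0 (subConst z₀ ^ N))) (2 * N + k)).1 z₀ = 0 := by
    rw [LinearMap.sum_apply, Finsupp.finsetSum_apply]
    have : ∀ s : Finset ℕ, ∀ F : ℕ → Hol, (∑ l ∈ s, F l).1 z₀ = ∑ l ∈ s, (F l).1 z₀ := by
      intro s F
      exact map_sum ((Pi.evalRingHom (fun _ : ℍ => ℂ) z₀).comp Hol.val.toRingHom) F s
    rw [this]
    refine Finset.sum_eq_zero fun l hl => ?_
    obtain ⟨q, -, hq⟩ := key l (Finset.mem_range.mp hl).le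
    have h0 : ((subConst z₀) ^ (N - l)).1 z₀ = 0 := by
      change ((z₀ : ℂ) - z₀) ^ (N - l) = 0
      rw [sub_self, zero_pow (Nat.sub_pos_of_lt (Finset.mem_range.mp hl)).ne']
    rw [hq]
    change _ * ((subConst z₀ ^ (N - l)).1 z₀ * q.1 z₀) = 0
    rw [h0, zero_mul, mul_zero]
  have h5 : toHol (k + 2 * (N - N)) (P.coeff N (k + 2 * (N - N))) = toHol k (P.coeff N k) := by
    rw [sub_self, mul_zero, add_zero]
  rw [LinearMap.add_apply, Finsupp.add_apply, hg', h5, Nat.sub_self, pow_zero, one_mul] at h1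
  change (_ : Hol).1 z₀ + P.coeff N k z₀ * g.1 z₀ = 0 at h1
  rw [hlow, zero_add] at h1
  exact (mul_eq_zero.mp h1).resolve_right hg

theorem ofCoeffs_injective : Function.Injective ofCoeffs := by
  intro P Q h
  have h1 := ofCoeffs_add (P - Q) Q
  rw [sub_add_cancel, h] at h1
  exact sub_eq_zero.mp
    (eq_zero_of_ofCoeffs_eq_zero ((eq_sub_of_add_eq h1.symm).trans (sub_self _)))

/-! ### Translation between `ord`, `top` and the filtration -/

theorem coeffs_ofCoeffs (P : Polynomial M) : coeffs (ofCoeffs P) = P := by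
  have h : ∃ Q, ofCoeffs Q = ofCoeffs P := ⟨P, rfl⟩
  rw [coeffs, dif_pos h]
  exact ofCoeffs_injective h.choose_spec

theorem ofCoeffs_mem_filt {n : ℕ} {P : Polynomial M} (h : P.degree < n) : ofCoeffs P ∈ filt n :=
  Submodule.sum_mem _ fun k hk => gen_mem_filt
    (Nat.cast_lt.mp ((Polynomial.le_degree_of_mem_supp k hk).trans_lt h)) _

theorem exists_ofCoeffs_of_mem_filt {n : ℕ} {a : EndH} (ha : a ∈ filt n) :
    ∃ P : Polynomial M, P.degree < n ∧ ofCoeffs P = a := by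
  induction ha using Submodule.span_induction with
  | mem x hx =>
    obtain ⟨k, hk, f, rfl⟩ := hx
    exact ⟨Polynomial.monomial k f, (Polynomial.degree_monomial_le k f).trans_lt
      (Nat.cast_lt.mpr hk), ofCoeffs_monomial k f⟩
  | zero => exact ⟨0, by simp, by simp [ofCoeffs]⟩
  | add x y _ _ hx hy =>
    obtain ⟨P, hP, rfl⟩ := hx
    obtain ⟨Q, hQ, rfl⟩ := hy
    exact ⟨P + Q, (Polynomial.degree_add_le P Q).trans_lt (max_lt hP hQ), ofCoeffs_add P Q⟩
  | smul c x _ hx =>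
    obtain ⟨P, hP, rfl⟩ := hx
    refine ⟨c • P, (Polynomial.degree_smul_le c P).trans_lt hP, ?_⟩
    rw [ofCoeffs, Polynomial.sum_smul_index' _ _ _ (by simp), ofCoeffs, Polynomial.sum_def,
      Polynomial.sum_def, Finset.smul_sum]
    simp

theorem ofCoeffs_coeffs {a : EndH} (ha : a ∈ R) : ofCoeffs (coeffs a) = a := by
  obtain ⟨n, hn⟩ := exists_mem_filt ha
  obtain ⟨P, -, rfl⟩ := exists_ofCoeffs_of_mem_filt hn
  rw [coeffs_ofCoeffs]

theorem ord_lt_of_mem_filt {n : ℕ} {a : EndH} (ha : a ∈ filt n) : ord a < n := by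
  obtain ⟨P, hP, rfl⟩ := exists_ofCoeffs_of_mem_filt ha
  rwa [ord, coeffs_ofCoeffs]

theorem hasSymbol_top {n : ℕ} {a : EndH} (ha : a ∈ R) (h : ord a = n) : HasSymbol n (top a) a := by
  have h1 : coeffs a ≠ 0 := by
    intro h0
    simp [ord, h0] at h
  have h2 : (coeffs a).natDegree = n := Polynomial.natDegree_eq_of_degree_eq_some h
  have h3 := ofCoeffs_add (coeffs a).eraseLead
    (Polynomial.monomial (coeffs a).natDegree (coeffs a).leadingCoeff)
  rw [Polynomial.eraseLead_add_monomial_natDegree_leadingCoeff, ofCoeffs_coeffs ha,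
    ofCoeffs_monomial, h2] at h3
  have h4 : a - iota (top a) * delta ^ n = ofCoeffs (coeffs a).eraseLead := by
    rw [sub_eq_iff_eq_add]
    exact h3
  rw [HasSymbol, h4]
  exact ofCoeffs_mem_filt (h ▸ Polynomial.degree_eraseLead_lt h1)

theorem top_ne_zero {n : ℕ} {a : EndH} (h : ord a = n) : top a ≠ 0 := by
  refine Polynomial.leadingCoeff_ne_zero.mpr fun h0 => ?_
  simp [ord, h0] at h

theorem HasSymbol.ord_eq {n : ℕ} {f : M} {a : EndH} (h : HasSymbol n f a) (hf : f ≠ 0) :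
    ord a = n := by
  obtain ⟨P, hP, h1⟩ := exists_ofCoeffs_of_mem_filt h
  have h2 : a = ofCoeffs (P + Polynomial.monomial n f) := by
    rw [ofCoeffs_add, ofCoeffs_monomial, h1, sub_add_cancel]
  rw [← Polynomial.degree_monomial n hf] at hP
  rw [h2, ord, coeffs_ofCoeffs, Polynomial.degree_add_eq_right_of_degree_lt hP,
    Polynomial.degree_monomial n hf]

/-! ### Projection to a fixed weight -/

/-- The weight `w` part of an endomorphism of `H`. -/
def weightPart (w : ℝ) : EndH →ₗ[ℂ] EndH where
  toFun φ := shift w fun n => Finsupp.lapply (n + w) ∘ₗ φ ∘ₗ Finsupp.lsingle n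
  map_add' φ ψ := Finsupp.lhom_ext fun n f => by
    rw [LinearMap.add_apply]
    simp [shift_single]
  map_smul' c φ := Finsupp.lhom_ext fun n f => by
    rw [LinearMap.smul_apply]
    simp [shift_single]

theorem weightPart_single (w : ℝ) (φ : EndH) (n : ℝ) (f : Hol) :
    weightPart w φ (Finsupp.single n f) =
      Finsupp.single (n + w) (φ (Finsupp.single n f) (n + w)) :=
  shift_single _ _ _ _

theorem weightPart_mem (w : ℝ) (φ : EndH) : weightPart w φ ∈ endWeight w :=
  fun n f => ⟨_, weightPart_single w φ n f⟩

theorem weightPart_eq_self {w : ℝ} {φ : EndH} (h : φ ∈ endWeight w) : weightPart w φ = φ :=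
  Finsupp.lhom_ext fun n f => by
    obtain ⟨g, hg⟩ := h n f
    rw [weightPart_single, hg, Finsupp.single_eq_same]

theorem weightPart_mul {v m w : ℝ} (h : v + m = w) (φ : EndH) {ψ : EndH} (hψ : ψ ∈ endWeight m) :
    weightPart w (φ * ψ) = weightPart v φ * ψ :=
  Finsupp.lhom_ext fun n f => by
    obtain ⟨g, hg⟩ := hψ n f
    rw [weightPart_single, Module.End.mul_apply, Module.End.mul_apply, hg, weightPart_single,
      show n + m + v = n + w by rw [← h]; ring]

theorem mul_weightPart {v m w : ℝ} (h : m + v = w) {ψ : EndH} (hψ : ψ ∈ endWeight m) (φ : EndH) :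
    weightPart w (ψ * φ) = ψ * weightPart v φ := by
  -- As ψ is homogeneous of weight m, the component of ψx at t + m depends only on that of x at t.
  have key : ∀ (x : H) (t : ℝ), ψ x (t + m) = ψ (Finsupp.single t (x t)) (t + m) := by
    intro x t
    induction x using Finsupp.induction_linear with
    | zero => simp
    | add x y hx hy => simp [hx, hy]
    | single s f =>
      rcases eq_or_ne s t with rfl | hst
      · rw [Finsupp.single_eq_same]
      · obtain ⟨g, hg⟩ := hψ s f
        rw [hg, Finsupp.single_eq_of_ne hst.symm, Finsupp.single_zero, map_zero,
          Finsupp.single_eq_of_ne (by simpa using hst.symm)]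
        rfl
  refine Finsupp.lhom_ext fun n f => ?_
  obtain ⟨g, hg⟩ := hψ (n + v) (φ (Finsupp.single n f) (n + v))
  rw [weightPart_single, Module.End.mul_apply, Module.End.mul_apply, weightPart_single,
    show n + w = n + v + m by rw [← h]; ring, key, hg, Finsupp.single_eq_same]

theorem mul_mem_endWeight {v m w : ℝ} (h : v + m = w) {φ ψ : EndH} (hφ : φ ∈ endWeight v)
    (hψ : ψ ∈ endWeight m) : φ * ψ ∈ endWeight w := by
  have := weightPart_mem w (φ * ψ)
  rwa [weightPart_mul h φ hψ, weightPart_eq_self hφ] at this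

theorem one_mem_endWeight : (1 : EndH) ∈ endWeight 0 := fun n f => ⟨f, by simp⟩

theorem pow_mem_endWeight {w : ℝ} {φ : EndH} (h : φ ∈ endWeight w) (k : ℕ) :
    φ ^ k ∈ endWeight (k * w) := by
  induction k with
  | zero => simpa using one_mem_endWeight
  | succ k ih =>
    rw [pow_succ]
    exact mul_mem_endWeight (by push_cast; ring) ih h

theorem delta_mem_endWeight : delta ∈ endWeight 2 := fun _ _ => ⟨_, shift_single _ _ _ _⟩

theorem mulForm_mem_endWeight (k : ℤ) (F : ModularForm 𝒮ℒ k) : mulForm k F ∈ endWeight k :=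
  fun _ _ => ⟨_, mulForm_single _ _ _ _⟩

theorem iota_mem_endWeight {k : ℤ} {f : M} (h : f ∈ MWeight k) : iota f ∈ endWeight k := by
  obtain ⟨F, rfl⟩ := h
  rw [iota_lof]
  exact mulForm_mem_endWeight k F

theorem weightPart_mulForm_of_ne {k : ℤ} {w : ℝ} (h : (k : ℝ) ≠ w) (F : ModularForm 𝒮ℒ k) :
    weightPart w (mulForm k F) = 0 :=
  Finsupp.lhom_ext fun n f => by
    rw [weightPart_single, mulForm_single, Finsupp.single_eq_of_ne (by simpa using h.symm)]
    simp

theorem exists_weightPart_iota (w : ℝ) (f : M) : ∃ g, weightPart w (iota f) = iota g := by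
  induction f using DirectSum.induction_on with
  | zero => exact ⟨0, by simp⟩
  | add x y hx hy =>
    obtain ⟨g, hg⟩ := hx
    obtain ⟨h, hh⟩ := hy
    exact ⟨g + h, by rw [map_add, map_add, hg, hh, map_add]⟩
  | of k F =>
    rcases eq_or_ne (k : ℝ) w with rfl | h
    · exact ⟨DirectSum.of (ModularForm 𝒮ℒ) k F, by
        rw [iota_of, weightPart_eq_self (mulForm_mem_endWeight k F)]⟩
    · exact ⟨0, by rw [iota_of, weightPart_mulForm_of_ne h, map_zero]⟩

/-- Since δ^k is homogeneous, projecting fδ^k only projects f. Hence taking weight parts of a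
remainder does not raise its order. -/
theorem weightPart_mem_filt (w : ℝ) {n : ℕ} {a : EndH} (ha : a ∈ filt n) :
    weightPart w a ∈ filt n := by
  have : filt n ≤ (filt n).comap (weightPart w) := by
    refine Submodule.span_le.mpr ?_
    rintro _ ⟨k, hk, f, rfl⟩
    obtain ⟨g, hg⟩ := exists_weightPart_iota (w - k * 2) f
    have h : weightPart w (iota f * delta ^ k) = iota g * delta ^ k := by
      rw [weightPart_mul (sub_add_cancel w _) _ (pow_mem_endWeight delta_mem_endWeight k), hg]
    simpa [h] using gen_mem_filt hk g
  exact this ha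

theorem weightPart_mem_R (w : ℝ) {a : EndH} (ha : a ∈ R) : weightPart w a ∈ R := by
  obtain ⟨n, hn⟩ := exists_mem_filt ha
  exact filt_le_R n (weightPart_mem_filt w hn)

/-! ### Pseudo-division by leading coefficients -/

/-- The operators which leave a remainder of order less than `j` on division by `b`, with the
quotient on the left of `b`. -/
def leftDivisible (j : ℕ) (b : EndH) : Submodule ℂ EndH where
  carrier := {x | ∃ c ∈ R, x - c * b ∈ filt j}
  zero_mem' := ⟨0, R.zero_mem, by simp⟩
  add_mem' := by
    rintro x y ⟨c, hc, hx⟩ ⟨d, hd, hy⟩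
    refine ⟨c + d, R.add_mem hc hd, ?_⟩
    rw [add_mul, add_sub_add_comm]
    exact add_mem hx hy
  smul_mem' := by
    rintro t x ⟨c, hc, hx⟩
    refine ⟨t • c, R.smul_mem hc t, ?_⟩
    rw [smul_mul_assoc, ← smul_sub]
    exact Submodule.smul_mem _ t hx

/-- The operators which leave a remainder of order less than `j` on division by `b`, with the
quotient on the right of `b`. -/
def rightDivisible (j : ℕ) (b : EndH) : Submodule ℂ EndH where
  carrier := {x | ∃ c ∈ R, x - b * c ∈ filt j}
  zero_mem' := ⟨0, R.zero_mem, by simp⟩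
  add_mem' := by
    rintro x y ⟨c, hc, hx⟩ ⟨d, hd, hy⟩
    refine ⟨c + d, R.add_mem hc hd, ?_⟩
    rw [mul_add, add_sub_add_comm]
    exact add_mem hx hy
  smul_mem' := by
    rintro t x ⟨c, hc, hx⟩
    refine ⟨t • c, R.smul_mem hc t, ?_⟩
    rw [mul_smul_comm, ← smul_sub]
    exact Submodule.smul_mem _ t hx

section

variable {j : ℕ} {b : EndH} {β : M}

theorem mem_leftDivisible_of_mem_filt {a : EndH} (ha : a ∈ filt j) : a ∈ leftDivisible j b :=
  ⟨0, R.zero_mem, by simpa using ha⟩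

theorem mem_rightDivisible_of_mem_filt {a : EndH} (ha : a ∈ filt j) : a ∈ rightDivisible j b :=
  ⟨0, R.zero_mem, by simpa using ha⟩

theorem mul_mem_leftDivisible {c : EndH} (hc : c ∈ R) : c * b ∈ leftDivisible j b :=
  ⟨c, hc, by simp⟩

theorem mul_mem_rightDivisible {c : EndH} (hc : c ∈ R) : b * c ∈ rightDivisible j b :=
  ⟨c, hc, by simp⟩

theorem iota_mul_mem_leftDivisible (f : M) {x : EndH} (hx : x ∈ leftDivisible j b) :
    iota f * x ∈ leftDivisible j b := by
  obtain ⟨c, hc, h⟩ := hx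
  refine ⟨iota f * c, R.mul_mem (iota_mem_R f) hc, ?_⟩
  rw [mul_assoc, ← mul_sub]
  exact iota_mul_mem_filt f h

theorem mul_iota_mem_rightDivisible (f : M) {x : EndH} (hx : x ∈ rightDivisible j b) :
    x * iota f ∈ rightDivisible j b := by
  obtain ⟨c, hc, h⟩ := hx
  refine ⟨c * iota f, R.mul_mem hc (iota_mem_R f), ?_⟩
  rw [← mul_assoc, ← sub_mul]
  exact mul_mem_filt le_rfl h (iota_mem_filt f)

/-- One factor β pays for one order: if α is the coefficient of a at δ^(j+r), then βa and αδ^r b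
agree there, and their difference falls to the case r. -/
theorem iota_pow_mul_mem_leftDivisible (hb : HasSymbol j β b) (r : ℕ) {a : EndH}
    (ha : a ∈ filt (j + r)) : iota (β ^ r) * a ∈ leftDivisible j b := by
  induction r generalizing a with
  | zero => simpa using mem_leftDivisible_of_mem_filt ha
  | succ r ih =>
    obtain ⟨α, hα⟩ := exists_hasSymbol ha
    have h1 : HasSymbol (j + r) (β * α) (iota β * a) := by
      simpa using (hasSymbol_iota β).mul hα
    have h2 : HasSymbol (j + r) (β * α) (iota α * delta ^ r * b) := by
      simpa [add_comm, mul_comm] using (hasSymbol_gen r α).mul hb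
    have h3 := add_mem (ih (h1.sub_mem_filt h2)) (iota_mul_mem_leftDivisible (β ^ r)
      (mul_mem_leftDivisible (R.mul_mem (iota_mem_R α) (R.pow_mem delta_mem_R r))))
    rwa [← mul_add, sub_add_cancel, ← mul_assoc, ← map_mul, ← pow_succ] at h3

theorem mul_iota_pow_mem_rightDivisible (hb : HasSymbol j β b) (r : ℕ) {a : EndH}
    (ha : a ∈ filt (j + r)) : a * iota (β ^ r) ∈ rightDivisible j b := by
  induction r generalizing a with
  | zero => simpa using mem_rightDivisible_of_mem_filt ha
  | succ r ih =>
    obtain ⟨α, hα⟩ := exists_hasSymbol ha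
    have h1 : HasSymbol (j + r) (α * β) (a * iota β) := by
      simpa using hα.mul (hasSymbol_iota β)
    have h2 : HasSymbol (j + r) (α * β) (b * (iota α * delta ^ r)) := by
      simpa [mul_comm] using hb.mul (hasSymbol_gen r α)
    have h3 := add_mem (ih (h1.sub_mem_filt h2)) (mul_iota_mem_rightDivisible (β ^ r)
      (mul_mem_rightDivisible (R.mul_mem (iota_mem_R α) (R.pow_mem delta_mem_R r))))
    rwa [← add_mul, sub_add_cancel, mul_assoc, ← map_mul, ← pow_succ'] at h3

variable {d a' b' : M} {r : ℕ} {a : EndH}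

/-- The first reduction needs only b' instead of β = b'd, as the leading coefficients share d; β^r
handles the rest. -/
theorem iota_mul_mem_leftDivisible_of_symbol (ha : HasSymbol (j + r) (a' * d) a)
    (hb : HasSymbol j (b' * d) b) :
    iota ((b' * d) ^ r * b') * a ∈ leftDivisible j b := by
  have h1 : HasSymbol (j + r) (b' * (a' * d)) (iota b' * a) := by
    simpa using (hasSymbol_iota b').mul ha
  have h2 : HasSymbol (j + r) (b' * (a' * d)) (iota a' * delta ^ r * b) := by
    have := (hasSymbol_gen r a').mul hb
    rwa [add_comm, mul_left_comm] at this
  have h3 := add_mem (iota_pow_mul_mem_leftDivisible hb r (h1.sub_mem_filt h2))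
    (iota_mul_mem_leftDivisible ((b' * d) ^ r)
      (mul_mem_leftDivisible (R.mul_mem (iota_mem_R a') (R.pow_mem delta_mem_R r))))
  rwa [← mul_add, sub_add_cancel, ← mul_assoc, ← map_mul] at h3

theorem mul_iota_mem_rightDivisible_of_symbol (ha : HasSymbol (j + r) (a' * d) a)
    (hb : HasSymbol j (b' * d) b) :
    a * iota ((b' * d) ^ r * b') ∈ rightDivisible j b := by
  have h1 : HasSymbol (j + r) (a' * d * b') (a * iota b') := by
    simpa using ha.mul (hasSymbol_iota b')
  have h2 : HasSymbol (j + r) (a' * d * b') (b * (iota a' * delta ^ r)) := by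
    have := hb.mul (hasSymbol_gen r a')
    rwa [show b' * d * a' = a' * d * b' by ring] at this
  have h3 := add_mem (mul_iota_pow_mem_rightDivisible hb r (h1.sub_mem_filt h2))
    (mul_iota_mem_rightDivisible ((b' * d) ^ r)
      (mul_mem_rightDivisible (R.mul_mem (iota_mem_R a') (R.pow_mem delta_mem_R r))))
  rwa [← add_mul, sub_add_cancel, mul_assoc, ← map_mul, mul_comm b'] at h3

/-! ### Moving powers of δ past the multiplier -/

theorem delta_mul_iota_mul {f g f' g' : M} (hf : delta * iota f = iota f * delta + iota f')
    (hg : delta * iota g = iota g * delta + iota g') :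
    delta * iota (f * g) = iota (f * g) * delta + iota (f' * g + f * g') := by
  rw [map_mul, ← mul_assoc, hf, add_mul, mul_assoc, hg, map_add, map_mul, map_mul]
  noncomm_ring

theorem exists_delta_mul_iota_pow (s : ℕ) (f : M) :
    ∃ g, delta * iota (f ^ (s + 1)) = iota (f ^ (s + 1)) * delta + iota (f ^ s * g) := by
  obtain ⟨f', hf⟩ := exists_delta_mul_iota f
  induction s with
  | zero => exact ⟨f', by simpa using hf⟩
  | succ s ih =>
    obtain ⟨g, hg⟩ := ih
    refine ⟨g + f', ?_⟩
    rw [pow_succ, delta_mul_iota_mul hg hf]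
    congr 2
    ring

theorem exists_delta_mul_iota_pow_mul (s : ℕ) (b' d : M) :
    ∃ g, delta * iota ((b' * d) ^ (s + 1) * b') =
      iota ((b' * d) ^ (s + 1) * b') * delta + iota ((b' * d) ^ s * b') * iota g := by
  obtain ⟨g, hg⟩ := exists_delta_mul_iota_pow s (b' * d)
  obtain ⟨h, hh⟩ := exists_delta_mul_iota b'
  -- Differentiating the last b' gives (b'd)^(s+1) h = (b'd)^s b' · dh, so the same factor comes out
  -- of both Leibniz terms.
  refine ⟨g + d * h, ?_⟩
  rw [delta_mul_iota_mul hg hh, ← map_mul]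
  congr 2
  ring

/-- The span of the terms which arise when `δ ^ l` is moved past `(b' d) ^ r b' x`. -/
def leibnizSpan (b' d : M) (r l : ℕ) : Submodule ℂ EndH :=
  Submodule.span ℂ ({x | ∃ s t : ℕ, t + r ≤ l + s + 1 ∧
      ∃ A ∈ filt t, iota ((b' * d) ^ s * b') * A = x} ∪ {x | ∃ t : ℕ, t + r ≤ l ∧ x ∈ filt t})

theorem mem_leibnizSpan {l s t : ℕ} (h : t + r ≤ l + s + 1) {A : EndH} (hA : A ∈ filt t) :
    iota ((b' * d) ^ s * b') * A ∈ leibnizSpan b' d r l :=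
  Submodule.subset_span (Or.inl ⟨s, t, h, A, hA, rfl⟩)

theorem mem_leibnizSpan_of_mem_filt {l t : ℕ} (h : t + r ≤ l) {A : EndH} (hA : A ∈ filt t) :
    A ∈ leibnizSpan b' d r l :=
  Submodule.subset_span (Or.inr ⟨t, h, hA⟩)

/-- Each δ either passes through, raising the order by one, or differentiates the coefficient,
costing at most one power of b'd. With s powers left, at least r - s of the l derivatives were
spent, so A has order at most l - (r - s). Differentiating b' itself at s = 0 leaves an order below
l - r, the second kind of generator. -/
theorem delta_mul_mem_leibnizSpan {l : ℕ} {x : EndH} (hx : x ∈ leibnizSpan b' d r l) :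
    delta * x ∈ leibnizSpan b' d r (l + 1) := by
  have : leibnizSpan b' d r l ≤
      (leibnizSpan b' d r (l + 1)).comap (LinearMap.mulLeft ℂ delta) := by
    refine Submodule.span_le.mpr ?_
    rintro _ (⟨s, t, h, A, hA, rfl⟩ | ⟨t, h, hA⟩)
    · change delta * _ ∈ leibnizSpan b' d r (l + 1)
      cases s with
      | zero =>
        obtain ⟨g, hg⟩ := exists_delta_mul_iota b'
        have h1 := add_mem (mem_leibnizSpan (b' := b') (d := d) (s := 0)
          (show t + 1 + r ≤ l + 1 + 0 + 1 by omega) (delta_mul_mem_filt hA))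
          (mem_leibnizSpan_of_mem_filt (show t + r ≤ l + 1 by omega) (iota_mul_mem_filt g hA))
        rw [pow_zero, one_mul] at h1 ⊢
        rwa [← mul_assoc, hg, add_mul, mul_assoc]
      | succ s =>
        obtain ⟨g, hg⟩ := exists_delta_mul_iota_pow_mul s b' d
        have h1 := add_mem (mem_leibnizSpan (b' := b') (d := d) (s := s + 1)
          (show t + 1 + r ≤ l + 1 + (s + 1) + 1 by omega) (delta_mul_mem_filt hA))
          (mem_leibnizSpan (show t + r ≤ l + 1 + s + 1 by omega) (iota_mul_mem_filt g hA))
        rwa [← mul_assoc, hg, add_mul, mul_assoc, mul_assoc]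
    · exact mem_leibnizSpan_of_mem_filt (show _ + 1 + r ≤ l + 1 by omega) (delta_mul_mem_filt hA)
  exact this hx

theorem delta_pow_mul_iota_mem_leibnizSpan (b' d : M) (r l : ℕ) :
    delta ^ l * iota ((b' * d) ^ r * b') ∈ leibnizSpan b' d r l := by
  induction l with
  | zero =>
    have := mem_leibnizSpan (b' := b') (d := d) (show 1 + r ≤ 0 + r + 1 by omega)
      (iota_mem_filt 1)
    simpa using this
  | succ l ih =>
    rw [pow_succ', mul_assoc]
    exact delta_mul_mem_leibnizSpan ih

/-- For l < j + r the cofactor of β^s b' lies in `filt (j + s)`, so the s remaining powers of β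
suffice. -/
theorem iota_mul_mem_leftDivisible_of_mem_leibnizSpan (hb : HasSymbol j (b' * d) b) {l : ℕ}
    (hl : l < j + r) (f : M) {x : EndH} (hx : x ∈ leibnizSpan b' d r l) :
    iota f * x ∈ leftDivisible j b := by
  have : leibnizSpan b' d r l ≤ (leftDivisible j b).comap (LinearMap.mulLeft ℂ (iota f)) := by
    refine Submodule.span_le.mpr ?_
    rintro _ (⟨s, t, h, A, hA, rfl⟩ | ⟨t, h, hA⟩)
    · change iota f * _ ∈ leftDivisible j b
      have h1 := iota_mul_mem_leftDivisible (f * b')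
        (iota_pow_mul_mem_leftDivisible hb s (filt_mono (by omega) hA))
      rwa [← mul_assoc, ← map_mul, mul_assoc, mul_comm b', map_mul, mul_assoc] at h1
    · change iota f * _ ∈ leftDivisible j b
      exact mem_leftDivisible_of_mem_filt (iota_mul_mem_filt f (filt_mono (by omega) hA))
  exact this hx

/-- At l = j + r the cofactor is only in `filt (j + s + 1)`; the missing factor β is formed from the
d in front and the b' of the multiplier. -/
theorem iota_mul_mem_leftDivisible_of_mem_leibnizSpan_top (hb : HasSymbol j (b' * d) b)
    (f : M) {x : EndH} (hx : x ∈ leibnizSpan b' d r (j + r)) :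
    iota (f * d) * x ∈ leftDivisible j b := by
  have : leibnizSpan b' d r (j + r) ≤
      (leftDivisible j b).comap (LinearMap.mulLeft ℂ (iota (f * d))) := by
    refine Submodule.span_le.mpr ?_
    rintro _ (⟨s, t, h, A, hA, rfl⟩ | ⟨t, h, hA⟩)
    · change iota (f * d) * _ ∈ leftDivisible j b
      have h1 := iota_mul_mem_leftDivisible f
        (iota_pow_mul_mem_leftDivisible hb (s + 1) (filt_mono (by omega) hA))
      rwa [← mul_assoc, ← map_mul,
        show f * (b' * d) ^ (s + 1) = f * d * ((b' * d) ^ s * b') by ring, map_mul, mul_assoc] at h1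
    · change iota (f * d) * _ ∈ leftDivisible j b
      exact mem_leftDivisible_of_mem_filt (iota_mul_mem_filt _ (filt_mono (by omega) hA))
  exact this hx

theorem mul_iota_mem_leftDivisible_of_symbol (ha : HasSymbol (j + r) (a' * d) a)
    (hb : HasSymbol j (b' * d) b) :
    a * iota ((b' * d) ^ r * b') ∈ leftDivisible j b := by
  have h1 : filt (j + r) ≤ (leftDivisible j b).comap
      (LinearMap.mulRight ℂ (iota ((b' * d) ^ r * b'))) := by
    refine Submodule.span_le.mpr ?_
    rintro _ ⟨l, hl, f, rfl⟩
    change iota f * delta ^ l * _ ∈ leftDivisible j b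
    rw [mul_assoc]
    exact iota_mul_mem_leftDivisible_of_mem_leibnizSpan hb hl f
      (delta_pow_mul_iota_mem_leibnizSpan b' d r l)
  have h2 := iota_mul_mem_leftDivisible_of_mem_leibnizSpan_top hb a'
    (delta_pow_mul_iota_mem_leibnizSpan b' d r (j + r))
  have h3 : (a - iota (a' * d) * delta ^ (j + r)) * iota ((b' * d) ^ r * b') ∈
      leftDivisible j b := h1 ha
  have h4 := add_mem h3 h2
  rwa [← mul_assoc, ← add_mul, sub_add_cancel] at h4

end

/-! ### Order and weight of the quotient -/

/-- Orders add because M is a domain; f ≠ 0 rules out c = 0. -/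
theorem ord_eq_of_hasSymbol_mul {j r : ℕ} {f β : M} {b c : EndH} (hc : c ∈ R)
    (hb : HasSymbol j β b) (hβ : β ≠ 0) (hf : f ≠ 0)
    (h : HasSymbol (j + r) f (c * b) ∨ HasSymbol (j + r) f (b * c)) :
    ord c = r := by
  obtain ⟨n, hn⟩ : ∃ n : ℕ, ord c = n := by
    suffices h0 : ord c ≠ ⊥ from (WithBot.ne_bot_iff_exists.mp h0).imp fun _ => Eq.symm
    intro h0
    have hc0 : c = 0 := by
      rw [← ofCoeffs_coeffs hc, Polynomial.degree_eq_bot.mp h0]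
      simp [ofCoeffs]
    have h1 : HasSymbol (j + r) f 0 := by simpa [hc0] using h
    have h2 := h1.ord_eq hf
    have h3 : ord 0 < (0 : ℕ) := ord_lt_of_mem_filt (zero_mem _)
    rw [h2, Nat.cast_lt] at h3
    exact absurd h3 (Nat.not_lt_zero _)
  have hc' := hasSymbol_top hc hn
  have htop := top_ne_zero hn
  rw [hn, Nat.cast_inj]
  rcases h with h | h
  · have h1 := (h.ord_eq hf).symm.trans ((hc'.mul hb).ord_eq (mul_ne_zero htop hβ))
    have := Nat.cast_inj.mp h1
    omega
  · have h1 := (h.ord_eq hf).symm.trans ((hb.mul hc').ord_eq (mul_ne_zero hβ htop))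
    have := Nat.cast_inj.mp h1
    omega

theorem exists_eq_mul_add {j r : ℕ} {f β : M} {b x : EndH} (hx : HasSymbol (j + r) f x)
    (hf : f ≠ 0) (hb : HasSymbol j β b) (hβ : β ≠ 0) (h : x ∈ leftDivisible j b) :
    ∃ c ∈ R, ∃ c' ∈ R, ord c = (r : WithBot ℕ) ∧ ord c' < (j : WithBot ℕ) ∧ x = c * b + c' := by
  obtain ⟨c, hc, hc'⟩ := h
  refine ⟨c, hc, _, filt_le_R j hc', ?_, ord_lt_of_mem_filt hc', (add_sub_cancel _ _).symm⟩
  exact ord_eq_of_hasSymbol_mul hc hb hβ hf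
    (Or.inl (hx.of_sub_mem (filt_mono (Nat.le_add_right j r) hc')))

theorem exists_eq_mul_add' {j r : ℕ} {f β : M} {b x : EndH} (hx : HasSymbol (j + r) f x)
    (hf : f ≠ 0) (hb : HasSymbol j β b) (hβ : β ≠ 0) (h : x ∈ rightDivisible j b) :
    ∃ c ∈ R, ∃ c' ∈ R, ord c = (r : WithBot ℕ) ∧ ord c' < (j : WithBot ℕ) ∧ x = b * c + c' := by
  obtain ⟨c, hc, hc'⟩ := h
  refine ⟨c, hc, _, filt_le_R j hc', ?_, ord_lt_of_mem_filt hc', (add_sub_cancel _ _).symm⟩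
  exact ord_eq_of_hasSymbol_mul hc hb hβ hf
    (Or.inr (hx.of_sub_mem (filt_mono (Nat.le_add_right j r) hc')))

theorem exists_eq_mul_add_of_weight {j r : ℕ} {f β : M} {b x : EndH} {m p q : ℤ}
    (hpq : p + m = q) (hbm : b ∈ endWeight m) (hxq : x ∈ endWeight q)
    (hx : HasSymbol (j + r) f x) (hf : f ≠ 0) (hb : HasSymbol j β b) (hβ : β ≠ 0)
    (h : x ∈ leftDivisible j b) :
    ∃ c ∈ RWeight p, ∃ c' ∈ RWeight q,
      ord c = (r : WithBot ℕ) ∧ ord c' < (j : WithBot ℕ) ∧ x = c * b + c' := by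
  obtain ⟨c, hc, hc'⟩ := h
  -- Projecting x - cb to weight q only projects c, as x and b are homogeneous; the new remainder is
  -- a weight part of the old one.
  have hw : x - weightPart p c * b = weightPart q (x - c * b) := by
    rw [map_sub, weightPart_eq_self hxq, weightPart_mul (v := p) (by exact_mod_cast hpq) c hbm]
  have hc'' := weightPart_mem_filt q hc'
  refine ⟨weightPart p c, ⟨weightPart_mem_R p hc, weightPart_mem p c⟩, weightPart q (x - c * b),
    ⟨filt_le_R j hc'', weightPart_mem q _⟩, ?_, ord_lt_of_mem_filt hc'', ?_⟩
  · refine ord_eq_of_hasSymbol_mul (weightPart_mem_R p hc) hb hβ hf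
      (Or.inl (hx.of_sub_mem (filt_mono (Nat.le_add_right j r) ?_)))
    rwa [hw]
  · rw [← hw, add_sub_cancel]

theorem exists_eq_mul_add_of_weight' {j r : ℕ} {f β : M} {b x : EndH} {m p q : ℤ}
    (hpq : m + p = q) (hbm : b ∈ endWeight m) (hxq : x ∈ endWeight q)
    (hx : HasSymbol (j + r) f x) (hf : f ≠ 0) (hb : HasSymbol j β b) (hβ : β ≠ 0)
    (h : x ∈ rightDivisible j b) :
    ∃ c ∈ RWeight p, ∃ c' ∈ RWeight q,
      ord c = (r : WithBot ℕ) ∧ ord c' < (j : WithBot ℕ) ∧ x = b * c + c' := by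
  obtain ⟨c, hc, hc'⟩ := h
  have hw : x - b * weightPart p c = weightPart q (x - b * c) := by
    rw [map_sub, weightPart_eq_self hxq, mul_weightPart (v := p) (by exact_mod_cast hpq) hbm c]
  have hc'' := weightPart_mem_filt q hc'
  refine ⟨weightPart p c, ⟨weightPart_mem_R p hc, weightPart_mem p c⟩, weightPart q (x - b * c),
    ⟨filt_le_R j hc'', weightPart_mem q _⟩, ?_, ord_lt_of_mem_filt hc'', ?_⟩
  · refine ord_eq_of_hasSymbol_mul (weightPart_mem_R p hc) hb hβ hf
      (Or.inr (hx.of_sub_mem (filt_mono (Nat.le_add_right j r) ?_)))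
    rwa [hw]
  · rw [← hw, add_sub_cancel]

theorem iota_pow_mul_mem_endWeight {b' d : M} {u v : ℤ} (hb : b' ∈ MWeight u) (hd : d ∈ MWeight v)
    (r : ℕ) : iota ((b' * d) ^ r * b') ∈ endWeight (r * (u + v) + u) := by
  rw [map_mul, map_pow, map_mul]
  exact mul_mem_endWeight rfl (pow_mem_endWeight
    (mul_mem_endWeight rfl (iota_mem_endWeight hb) (iota_mem_endWeight hd)) r)
    (iota_mem_endWeight hb)

end MLDO
end

theorem mainTheorem5 :
    -- inhomogeneous version
    (∀ (i j : ℕ) (_ : j ≤ i) (a b : MLDO.EndH) (d a' b' : MLDO.M),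
      a ∈ MLDO.R → MLDO.ord a = (i : WithBot ℕ) →
      b ∈ MLDO.R → MLDO.ord b = (j : WithBot ℕ) →
      MLDO.top a = a' * d → MLDO.top b = b' * d →
      (∃ c ∈ MLDO.R, ∃ c' ∈ MLDO.R,
        MLDO.ord c = ((i - j : ℕ) : WithBot ℕ) ∧ MLDO.ord c' < (j : WithBot ℕ) ∧
        MLDO.iota (MLDO.top b ^ (i - j) * b') * a = c * b + c') ∧
      (∃ c ∈ MLDO.R, ∃ c' ∈ MLDO.R,
        MLDO.ord c = ((i - j : ℕ) : WithBot ℕ) ∧ MLDO.ord c' < (j : WithBot ℕ) ∧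
        a * MLDO.iota (MLDO.top b ^ (i - j) * b') = b * c + c')) ∧
    -- homogeneous version
    (∀ (i j : ℕ) (_ : j ≤ i) (m n l p q : ℤ) (_ : 0 ≤ m) (_ : 0 ≤ n)
      (_ : p = (m - 2 * j) * (i - j + 1) - l - m + n)
      (_ : q = (m - 2 * j) * (i - j + 1) - l + n)
      (a b : MLDO.EndH) (d a' b' : MLDO.M),
      a ∈ MLDO.RWeight n → MLDO.ord a = (i : WithBot ℕ) →
      b ∈ MLDO.RWeight m → MLDO.ord b = (j : WithBot ℕ) →
      d ∈ MLDO.MWeight l → a' ∈ MLDO.MWeight (n - 2 * i - l) →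
      b' ∈ MLDO.MWeight (m - 2 * j - l) →
      MLDO.top a = a' * d → MLDO.top b = b' * d →
      (∃ c ∈ MLDO.RWeight p, ∃ c' ∈ MLDO.RWeight q,
        MLDO.ord c = ((i - j : ℕ) : WithBot ℕ) ∧ MLDO.ord c' < (j : WithBot ℕ) ∧
        MLDO.iota (MLDO.top b ^ (i - j) * b') * a = c * b + c') ∧
      (∃ c ∈ MLDO.RWeight p, ∃ c' ∈ MLDO.RWeight q,
        MLDO.ord c = ((i - j : ℕ) : WithBot ℕ) ∧ MLDO.ord c' < (j : WithBot ℕ) ∧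
        a * MLDO.iota (MLDO.top b ^ (i - j) * b') = b * c + c') ∧
      (∃ c ∈ MLDO.RWeight p, ∃ c' ∈ MLDO.RWeight q,
        MLDO.ord c = ((i - j : ℕ) : WithBot ℕ) ∧ MLDO.ord c' < (j : WithBot ℕ) ∧
        a * MLDO.iota (MLDO.top b ^ (i - j) * b') = c * b + c')) := by

  -- On either side of a the multiplier gives the same nonzero leading coefficient, from which the
  -- order of c is found.
  have key : ∀ {i j r : ℕ} {a b : MLDO.EndH} {d a' b' : MLDO.M}, i = j + r →
      a ∈ MLDO.R → MLDO.ord a = (i : WithBot ℕ) → b ∈ MLDO.R → MLDO.ord b = (j : WithBot ℕ) →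
      MLDO.top a = a' * d → MLDO.top b = b' * d →
      MLDO.HasSymbol (j + r) (a' * d) a ∧ MLDO.HasSymbol j (b' * d) b ∧ b' * d ≠ 0 ∧
      (b' * d) ^ r * b' * (a' * d) ≠ 0 ∧
      MLDO.HasSymbol (j + r) ((b' * d) ^ r * b' * (a' * d))
        (MLDO.iota ((b' * d) ^ r * b') * a) ∧
      MLDO.HasSymbol (j + r) ((b' * d) ^ r * b' * (a' * d))
        (a * MLDO.iota ((b' * d) ^ r * b')) := by
    rintro i j r a b d a' b' rfl ha hia hb hjb hta htb
    have h1 := MLDO.hasSymbol_top ha hia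
    have h2 := MLDO.hasSymbol_top hb hjb
    have h3 := MLDO.top_ne_zero hia
    have h4 := MLDO.top_ne_zero hjb
    rw [hta] at h1 h3
    rw [htb] at h2 h4
    refine ⟨h1, h2, h4, mul_ne_zero (mul_ne_zero (pow_ne_zero _ h4) (left_ne_zero_of_mul h4)) h3,
      ?_, ?_⟩
    · have := (MLDO.hasSymbol_iota ((b' * d) ^ r * b')).mul h1
      rwa [zero_add] at this
    · have := h1.mul (MLDO.hasSymbol_iota ((b' * d) ^ r * b'))
      rwa [add_zero, mul_comm] at this
  refine ⟨fun i j hij a b d a' b' ha hia hb hjb hta htb => ?_,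
    fun i j hij m n l p q _ _ hp hq a b d a' b' ha hia hb hjb hd ha' hb' hta htb => ?_⟩
  · obtain ⟨h1, h2, h3, h4, h5, h6⟩ :=
      key (Nat.add_sub_of_le hij).symm ha hia hb hjb hta htb
    rw [htb]
    exact ⟨MLDO.exists_eq_mul_add h5 h4 h2 h3 (MLDO.iota_mul_mem_leftDivisible_of_symbol h1 h2),
      MLDO.exists_eq_mul_add' h6 h4 h2 h3 (MLDO.mul_iota_mem_rightDivisible_of_symbol h1 h2)⟩
  · obtain ⟨h1, h2, h3, h4, h5, h6⟩ :=
      key (Nat.add_sub_of_le hij).symm ha.1 hia hb.1 hjb hta htb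
    have hw := MLDO.iota_pow_mul_mem_endWeight hb' hd (i - j)
    have hpq : p + m = q := by rw [hp, hq]; ring
    -- The weight q is that of β^(i-j) b' plus n, where b' and d have weights m - 2j - l and l.
    have hq' : (q : ℝ) = ((i - j : ℕ) : ℝ) * (((m - 2 * j - l : ℤ) : ℝ) + l) +
        ((m - 2 * j - l : ℤ) : ℝ) + n := by
      rw [hq, Nat.cast_sub hij]
      push_cast
      ring
    have hx := MLDO.mul_mem_endWeight hq'.symm hw ha.2
    have hy := MLDO.mul_mem_endWeight ((add_comm _ _).trans hq'.symm) ha.2 hw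
    rw [htb]
    exact ⟨MLDO.exists_eq_mul_add_of_weight hpq hb.2 hx h5 h4 h2 h3
        (MLDO.iota_mul_mem_leftDivisible_of_symbol h1 h2),
      MLDO.exists_eq_mul_add_of_weight' ((add_comm _ _).trans hpq) hb.2 hy h6 h4 h2 h3
        (MLDO.mul_iota_mem_rightDivisible_of_symbol h1 h2),
      MLDO.exists_eq_mul_add_of_weight hpq hb.2 hy h6 h4 h2 h3
        (MLDO.mul_iota_mem_leftDivisible_of_symbol h1 h2)⟩
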